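/- **Setting.** A link $I_i$ is an interval $[a_i,b_i]$ with a fundamental diagram $f_i:[0,\rho_{j,i}]\to\mathbb R$ that is continuous, concave and vanishes at $0$ and $\rho_{j,i}$, with capacity $C_i=\max f_i$, transform $f_i^*(u)=\sup_{\rho\in[0,\rho_{j,i}]}(f_i(\rho)-u\rho)$, and a measurable initial density $\rho_i^0$ with values in $[0,\rho_{j,i}]$; put $N^i_{ini}(x)=\int_x^{b_i}\rho_i^0$. Given upstream and downstream conditions $N_{up},N_{down}$ on $[0,T]$, the Moskowitz function of the link is the solution of $\partial_tN-f_i(-\partial_xN)=0$ given by the generalized Lax–Hopf formula $$N(t,x)=\inf_{u\in\mathbb R,\ \tau\ge 0}\{\mathcal C(t-\tau,x-\tau u)+\tau f_i^*(u)\},\qquad (t,x)\in[0,T]\times[a_i,b_i],$$ where $\mathcal C$ consists of $N^i_{ini}$ on $\{0\}\times[a_i,b_i]$, $N_{up}$ on $[0,T]\times\{a_i\}$ and $N_{down}$ on $[0,T]\times\{b_i\}$ (the smallest value where these overlap, and $+\infty$ elsewhere). Consider a finite network of such links in which no link precedes itself. A link $I_j$ may be followed by one link $I_k$; all links followed by $I_k$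 meet at a junction (merge) with outgoing link $I_k$, with cycle length $\Delta_k>0$. An incoming link $I_j$ has a split parameter $\eta_j\in(0,1]$ and a measurable, $\Delta_k$-periodic signal $u_j:\mathbb R\to\{0,1\}$ with $\int_0^{\Delta_k}u_j=\eta_j\Delta_k$; at every time exactly one incoming link of each junction has $u_j=1$. The supply $S_k(t)$ of $I_k$ is $C_k$ if the entrance of $I_k$ is in the uncongested phase at time $t$ (that is, $\rho_k(t,a_k+)=-\partial_xN^k(t,a_k+)$ exists and lies between $0$ and some critical density, at which $f_k=C_k$), and $f_k(\rho_k(t,a_k+))$ otherwise. In the on-and-off model (solution $N^{\Delta,i}$) and in the continuum model (solution $N^{0,i}$) the Moskowitz function of each link has the downstream condition $$N^{\Delta,j}_{down}(t)=\int_0^t\min\{C_j,S_k\}\,u_j\,d\tau,\qquad N^{0,j}_{down}(t)=\int_0^t\eta_j\min\{C_j,S_k\}\,d\tau$$ respectively ($S_k$ being the supply in the respective model), and in both models the upstream condition $N^k_{up}(t)=N^k_{ini}(a_k)+\sum_{j}N^j(t,b_j)$, summed over the links $I_j$ followed by $I_k$. For a link without predecessors the sum is replaced by the time-integral of a given non-negative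 integrable demand, and for a link without successor $N_{down}$ is the time-integral of a given non-negative integrable supply; these data are the same in both models. **Statement.** Assume that in both models the entrance of every link is in the uncongested phase for almost every $t\in[0,T]$. For each link $I_j$ fix the upstream condition $U_j$ to be the one that $I_j$ has in the on-and-off model or the one it has in the continuum model, and let $e_j(t,x)$ be the absolute difference of the two Moskowitz functions of the single link $I_j$ with this same upstream condition $U_j$ and with the downstream conditions $N^{\Delta,j}_{down}$ and $N^{0,j}_{down}$ respectively. Then for every link $I_i$ and all $(t,x)\in[0,T]\times[a_i,b_i]$ $$\bigl|N^{\Delta,i}(t,x)-N^{0,i}(t,x)\bigr|\ \le\ \sum_{j}\ \sup_{s\in[0,t],\ y\in[a_j,b_j]}e_j(s,y),$$ where $I_j$ runs over the links preceding $I_i$, including $I_i$ itself (those from which $I_i$ is reached by passing zero or more times to the following link). Moreover, for every link $I_j$ and all $(t,x)\in[0,T]\times[a_j,b_j]$, $$e_j(t,x)\ \le\ \eta_j(1-\eta_j)\,\Delta_k\,\min\{C_j,C_k\}$$ if $I_j$ is followed by $I_k$, and $e_j(t,x)=0$ if no link follows $I_j$. -/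

import Mathlib

open Set MeasureTheory

noncomputable section

namespace SignalNetwork

/-- A fundamental diagram on `[0, ρj]`: continuous, concave, vanishing at `0` and at `ρj`. -/
structure FundamentalDiagram where
  f : ℝ → ℝ
  ρj : ℝ
  ρj_pos : 0 < ρj
  cont : ContinuousOn f (Icc 0 ρj)
  conc : ConcaveOn ℝ (Icc 0 ρj) f
  f_zero : f 0 = 0
  f_jam : f ρj = 0

/-- The flow capacity, i.e. the maximum of `f` on `[0, ρj]`. -/
def FundamentalDiagram.capacity (F : FundamentalDiagram) : ℝ :=
  sSup (F.f '' Icc 0 F.ρj)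

/-- The concave transform `f^*(u) = sup_{ρ ∈ [0, ρj]} (f ρ - u ρ)`; it is finite for every real
`u`, so its domain is `ℝ`. -/
def FundamentalDiagram.transform (F : FundamentalDiagram) (u : ℝ) : ℝ :=
  sSup ((fun ρ => F.f ρ - u * ρ) '' Icc 0 F.ρj)

/-- A density is in the uncongested phase if it does not exceed a critical density
(a density at which the capacity is attained). -/
def FundamentalDiagram.Uncongested (F : FundamentalDiagram) (ρ : ℝ) : Prop :=
  ∃ ρc ∈ Icc 0 F.ρj, F.f ρc = F.capacity ∧ ρ ∈ Icc 0 ρc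

/-- A road link: the interval `[a, b]`, its fundamental diagram, and its initial density. -/
structure Link extends FundamentalDiagram where
  a : ℝ
  b : ℝ
  a_lt_b : a < b
  ρ₀ : ℝ → ℝ
  ρ₀_meas : Measurable ρ₀
  ρ₀_mem : ∀ x ∈ Icc a b, ρ₀ x ∈ Icc 0 ρj

/-- The initial Moskowitz function, normalized to vanish at the exit of the link: the number of
vehicles initially located downstream of `x`. -/
def Link.Nini (L : Link) (x : ℝ) : ℝ := ∫ y in x..L.b, L.ρ₀ y

/-- `L.IsValue T Nup Ndown t x c`: the value condition made of the initial condition and of the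
upstream and downstream conditions `Nup`, `Ndown` takes the value `c` at `(t, x)`. -/
def Link.IsValue (L : Link) (T : ℝ) (Nup Ndown : ℝ → ℝ) (t x c : ℝ) : Prop :=
  (t = 0 ∧ x ∈ Icc L.a L.b ∧ c = L.Nini x) ∨
  (t ∈ Icc 0 T ∧ x = L.a ∧ c = Nup t) ∨
  (t ∈ Icc 0 T ∧ x = L.b ∧ c = Ndown t)

/-- The Moskowitz function of a link with weak upstream and downstream conditions `Nup`, `Ndown`:
the solution of `∂ₜ N - f (-∂ₓ N) = 0` given by the generalized Lax-Hopf formula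
`N (t, x) = inf_{u, τ ≥ 0} (C (t - τ, x - τ u) + τ f^*(u))`, where the infimum extends over the
points of the domain of the value condition `C`. -/
def Link.moskowitz (L : Link) (T : ℝ) (Nup Ndown : ℝ → ℝ) (t x : ℝ) : ℝ :=
  sInf {y | ∃ u τ c : ℝ, 0 ≤ τ ∧ L.IsValue T Nup Ndown (t - τ) (x - τ * u) c ∧
    y = c + τ * L.transform u}

/-- The density `ρ (t, a+) = -∂ₓ N (t, a+)` at the entrance of the link. -/
def Link.entranceDensity (L : Link) (N : ℝ → ℝ → ℝ) (t : ℝ) : ℝ :=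
  -derivWithin (N t) (Icc L.a L.b) L.a

/-- At time `t` the entrance of the link is in the uncongested phase: the density has a trace
there, and this trace is in the uncongested phase. -/
def Link.EntranceUncongested (L : Link) (N : ℝ → ℝ → ℝ) (t : ℝ) : Prop :=
  DifferentiableWithinAt ℝ (N t) (Icc L.a L.b) L.a ∧ L.Uncongested (L.entranceDensity N t)

open Classical in
/-- The supply of a link: its capacity if its entrance is uncongested, and the flow at the entrance
otherwise. -/
def Link.supply (L : Link) (N : ℝ → ℝ → ℝ) (t : ℝ) : ℝ :=
  if L.EntranceUncongested N t then L.capacity else L.f (L.entranceDensity N t)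

end SignalNetwork

open SignalNetwork

/-- A network of links `ι` joined by signalized merge junctions, over the time horizon `[0, T]`.
A junction has one outgoing link, by which it is named; its incoming links are the links `j` with
`next j = some k`. A link without predecessors is an origin, a link with `next j = none` a
destination. -/
structure SignalNetwork (ι : Type*) [Fintype ι] where
  T : ℝ
  T_pos : 0 < T
  link : ι → Link
  /-- the link that follows a given link, if any -/
  next : ι → Option ι
  /-- no link precedes itself -/
  acyclic : ∀ i, ¬ Relation.TransGen (fun j k => next j = some k) i i
  /-- the cycle length of the junction with outgoing link `k` -/
  cycle : ι → ℝ
  cycle_pos : ∀ k, 0 < cycle k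
  /-- the split parameter of an incoming link -/
  η : ι → ℝ
  η_mem : ∀ j k, next j = some k → η j ∈ Ioc 0 1
  /-- the signal control at the exit of an incoming link: `1` is green, `0` is red -/
  u : ι → ℝ → ℝ
  u_meas : ∀ j k, next j = some k → Measurable (u j)
  u_mem : ∀ j k, next j = some k → ∀ t, u j t = 0 ∨ u j t = 1
  u_periodic : ∀ j k, next j = some k → Function.Periodic (u j) (cycle k)
  /-- the green time within one cycle is `η` times the cycle length -/
  u_green : ∀ j k, next j = some k → ∫ t in (0 : ℝ)..cycle k, u j t = η j * cycle k
  /-- at each junction exactly one incoming link has green at any time -/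
  u_unique : ∀ j k, next j = some k → ∀ t, ∃! l, next l = some k ∧ u l t = 1
  /-- the exogenous demand at the entrance of an origin -/
  demand : ι → ℝ → ℝ
  demand_nonneg : ∀ i, ∀ t ∈ Icc 0 T, 0 ≤ demand i t
  demand_int : ∀ i, IntervalIntegrable (demand i) volume 0 T
  /-- the exogenous supply at the exit of a destination -/
  exitSupply : ι → ℝ → ℝ
  exitSupply_nonneg : ∀ i, ∀ t ∈ Icc 0 T, 0 ≤ exitSupply i t
  exitSupply_int : ∀ i, IntervalIntegrable (exitSupply i) volume 0 T

namespace SignalNetwork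

variable {ι : Type*} [Fintype ι]

open Classical in
/-- The links that precede `i`, including `i` itself. -/
def preceding (net : SignalNetwork ι) (i : ι) : Finset ι :=
  Finset.univ.filter fun j => Relation.ReflTransGen (fun k l => net.next k = some l) j i

open Classical in
/-- The upstream condition of link `i` when the Moskowitz functions are `N`: the vehicles initially
on the link, plus those that left the incoming links of the junction at its entrance (the inflow of
the outgoing link is the sum of the exit flows of the incoming ones); for an origin, the
time-integral of the exogenous demand takes the place of the latter. -/
def upstream (net : SignalNetwork ι) (N : ι → ℝ → ℝ → ℝ) (i : ι) (t : ℝ) : ℝ :=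
  (net.link i).Nini (net.link i).a +
    if ∃ j, net.next j = some i then
      ∑ j ∈ Finset.univ.filter (fun j => net.next j = some i), N j t (net.link j).b
    else ∫ s in (0 : ℝ)..t, net.demand i s

/-- The downstream condition of link `j` under the control `c`: the time-integral of the effective
supply `min {C_j, S_k}` of the following link `k`, multiplied by the control `c j`; for a
destination, the time-integral of the exogenous supply. -/
def downstream (net : SignalNetwork ι) (c : ι → ℝ → ℝ) (N : ι → ℝ → ℝ → ℝ) (j : ι) (t : ℝ) : ℝ :=
  match net.next j with
  | some k => ∫ s in (0 : ℝ)..t, min (net.link j).capacity ((net.link k).supply (N k) s) * c j s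
  | none => ∫ s in (0 : ℝ)..t, net.exitSupply j s

/-- The on-and-off control. -/
def onOff (net : SignalNetwork ι) : ι → ℝ → ℝ := net.u

/-- The continuum control: the signal is replaced by the split parameter. -/
def continuum (net : SignalNetwork ι) : ι → ℝ → ℝ := fun j _ => net.η j

/-- `N` is the family of Moskowitz functions of the network under the control `c`. -/
def IsSolution (net : SignalNetwork ι) (c : ι → ℝ → ℝ) (N : ι → ℝ → ℝ → ℝ) : Prop :=
  ∀ i, ∀ t ∈ Icc 0 net.T, ∀ x ∈ Icc (net.link i).a (net.link i).b,
    N i t x = (net.link i).moskowitz net.T (net.upstream N i) (net.downstream c N i) t x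

/-- No spillback: the entrance of every link remains in the uncongested phase. -/
def NoSpillback (net : SignalNetwork ι) (N : ι → ℝ → ℝ → ℝ) : Prop :=
  ∀ i, ∀ᵐ t ∂(volume.restrict (Icc 0 net.T)), (net.link i).EntranceUncongested (N i) t

/-- The difference at `(t, x)` of the two Moskowitz functions of the single link `j` that have the
same upstream condition `Nup`, and the downstream conditions of the on-and-off model (with solution
`NΔ`) and of the continuum model (with solution `N0`) respectively. -/
def linkError (net : SignalNetwork ι) (NΔ N0 : ι → ℝ → ℝ → ℝ) (j : ι) (Nup : ℝ → ℝ)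
    (t x : ℝ) : ℝ :=
  |(net.link j).moskowitz net.T Nup (net.downstream net.onOff NΔ j) t x -
    (net.link j).moskowitz net.T Nup (net.downstream net.continuum N0 j) t x|

/-- The maximal difference on the link up to time `t`. -/
def maxLinkError (net : SignalNetwork ι) (NΔ N0 : ι → ℝ → ℝ → ℝ) (j : ι) (Nup : ℝ → ℝ)
    (t : ℝ) : ℝ :=
  sSup {e | ∃ s ∈ Icc 0 t, ∃ y ∈ Icc (net.link j).a (net.link j).b,
    e = net.linkError NΔ N0 j Nup s y}

/-- `η_j (1 - η_j) Δ min {C_j, C_k}` for a link `j` followed by the link `k` at a junction of cycle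
length `Δ`; `0` for a destination, which has no signal. -/
def signalBound (net : SignalNetwork ι) (j : ι) : ℝ :=
  match net.next j with
  | some k => net.η j * (1 - net.η j) * net.cycle k *
      min (net.link j).capacity (net.link k).capacity
  | none => 0

end SignalNetwork

end

open Set MeasureTheory

namespace SignalNetwork

/-! ### The Moskowitz function of a single link -/

/-! The Lax–Hopf formula is an infimum of boundary values plus costs that do not depend on them, so
the Moskowitz function is causal and nonexpansive in the sup norm of its boundary conditions
(`Link.abs_moskowitz_sub_le`).

Without spillback the supply equals the capacity almost everywhere. The two downstream conditions of
a link are then one constant times the integrals of `u` and of `η`. These integrals differ by at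
most `η (1 - η) Δ`, because `u - η` is periodic with mean zero (`abs_integral_signal_sub_le`); this
bounds the link error.

For the network, induct from the origins downstream. On each link, insert the Moskowitz function
with one model's upstream and the other's downstream condition. One difference is the link error;
the other is at most the sum of the exit errors of the incoming links. Each link has at most one
successor and there are no cycles, so the sums over predecessors are disjoint and add up
(`sum_preceding`). -/

theorem FundamentalDiagram.capacity_nonneg (F : FundamentalDiagram) : 0 ≤ F.capacity :=
  Real.sSup_nonneg' ⟨F.f 0, ⟨0, left_mem_Icc.2 F.ρj_pos.le, rfl⟩, F.f_zero.ge⟩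

theorem FundamentalDiagram.transform_nonneg (F : FundamentalDiagram) (u : ℝ) :
    0 ≤ F.transform u :=
  Real.sSup_nonneg' ⟨0, ⟨0, left_mem_Icc.2 F.ρj_pos.le, by simp [F.f_zero]⟩, le_rfl⟩

theorem Link.Nini_nonneg (L : Link) {x : ℝ} (hx : x ∈ Icc L.a L.b) : 0 ≤ L.Nini x :=
  intervalIntegral.integral_nonneg hx.2 fun y hy =>
    (L.ρ₀_mem y ⟨hx.1.trans hy.1, hy.2⟩).1

theorem Link.IsValue.nonneg {L : Link} {T : ℝ} {Nup Ndown : ℝ → ℝ}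
    (hup : ∀ t ∈ Icc 0 T, 0 ≤ Nup t) (hdown : ∀ t ∈ Icc 0 T, 0 ≤ Ndown t)
    {t x c : ℝ} (h : L.IsValue T Nup Ndown t x c) : 0 ≤ c := by
  rcases h with ⟨-, hx, rfl⟩ | ⟨ht, -, rfl⟩ | ⟨ht, -, rfl⟩
  exacts [L.Nini_nonneg hx, hup t ht, hdown t ht]

theorem Link.moskowitz_nonneg (L : Link) {T : ℝ} {Nup Ndown : ℝ → ℝ}
    (hup : ∀ t ∈ Icc 0 T, 0 ≤ Nup t) (hdown : ∀ t ∈ Icc 0 T, 0 ≤ Ndown t) (t x : ℝ) :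
    0 ≤ L.moskowitz T Nup Ndown t x := by
  refine Real.sInf_nonneg ?_
  rintro _ ⟨u, τ, c, hτ, hc, rfl⟩
  exact add_nonneg (hc.nonneg hup hdown) (mul_nonneg hτ (L.transform_nonneg u))

/-- If the boundary conditions increase by at most `ε` up to time `t`, so does the Moskowitz
function. -/
theorem Link.moskowitz_le_add (L : Link) {T : ℝ} {Nup Ndown Nup' Ndown' : ℝ → ℝ}
    (hup : ∀ t ∈ Icc 0 T, 0 ≤ Nup t) (hdown : ∀ t ∈ Icc 0 T, 0 ≤ Ndown t)
    {t x ε : ℝ} (ht : t ∈ Icc 0 T) (hx : x ∈ Icc L.a L.b) (hε : 0 ≤ ε)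
    (hup' : ∀ s ∈ Icc 0 t, Nup s ≤ Nup' s + ε) (hdown' : ∀ s ∈ Icc 0 t, Ndown s ≤ Ndown' s + ε) :
    L.moskowitz T Nup Ndown t x ≤ L.moskowitz T Nup' Ndown' t x + ε := by
  rw [← sub_le_iff_le_add]
  -- The ray of speed `0` goes back to the initial condition at `(0, x)`, so the set of candidates
  -- is nonempty.
  refine le_csInf ⟨_, 0, t, L.Nini x, ht.1, Or.inl ⟨by simp, by simpa using hx, by simp⟩, rfl⟩ ?_
  rintro _ ⟨u, τ, c, hτ, hc, rfl⟩
  rw [sub_le_iff_le_add]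
  -- The same ray is used for both data sets. It ends at time `t - τ ≤ t`, so only boundary values
  -- up to time `t` matter.
  obtain ⟨d, hd, hdc⟩ : ∃ d, L.IsValue T Nup Ndown (t - τ) (x - τ * u) d ∧ d ≤ c + ε := by
    rcases hc with ⟨h1, h2, rfl⟩ | ⟨h1, h2, rfl⟩ | ⟨h1, h2, rfl⟩
    · exact ⟨_, Or.inl ⟨h1, h2, rfl⟩, by linarith⟩
    · exact ⟨_, Or.inr (Or.inl ⟨h1, h2, rfl⟩), hup' _ ⟨h1.1, by linarith⟩⟩
    · exact ⟨_, Or.inr (Or.inr ⟨h1, h2, rfl⟩), hdown' _ ⟨h1.1, by linarith⟩⟩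
  -- A real `sInf` is a genuine infimum only if the set is bounded below; nonnegative boundary data
  -- ensure this.
  have hbdd : BddBelow {y | ∃ u τ c : ℝ, 0 ≤ τ ∧ L.IsValue T Nup Ndown (t - τ) (x - τ * u) c ∧
      y = c + τ * L.transform u} := by
    refine ⟨0, ?_⟩
    rintro _ ⟨u, τ, c, hτ, hc, rfl⟩
    exact add_nonneg (hc.nonneg hup hdown) (mul_nonneg hτ (L.transform_nonneg u))
  calc L.moskowitz T Nup Ndown t x ≤ d + τ * L.transform u := csInf_le hbdd ⟨u, τ, d, hτ, hd, rfl⟩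
    _ ≤ c + τ * L.transform u + ε := by linarith

/-- The Moskowitz function is a nonexpansive function of the boundary conditions. -/
theorem Link.abs_moskowitz_sub_le (L : Link) {T : ℝ} {Nup Ndown Nup' Ndown' : ℝ → ℝ}
    (hup : ∀ t ∈ Icc 0 T, 0 ≤ Nup t) (hdown : ∀ t ∈ Icc 0 T, 0 ≤ Ndown t)
    (hup' : ∀ t ∈ Icc 0 T, 0 ≤ Nup' t) (hdown' : ∀ t ∈ Icc 0 T, 0 ≤ Ndown' t)
    {t x ε : ℝ} (ht : t ∈ Icc 0 T) (hx : x ∈ Icc L.a L.b) (hε : 0 ≤ ε)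
    (h : ∀ s ∈ Icc 0 t, |Nup s - Nup' s| ≤ ε) (h' : ∀ s ∈ Icc 0 t, |Ndown s - Ndown' s| ≤ ε) :
    |L.moskowitz T Nup Ndown t x - L.moskowitz T Nup' Ndown' t x| ≤ ε := by
  have h1 := L.moskowitz_le_add hup hdown ht hx hε (Nup' := Nup') (Ndown' := Ndown')
    (fun s hs => by linarith [(abs_le.1 (h s hs)).2])
    (fun s hs => by linarith [(abs_le.1 (h' s hs)).2])
  have h2 := L.moskowitz_le_add hup' hdown' ht hx hε (Nup' := Nup) (Ndown' := Ndown)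
    (fun s hs => by linarith [(abs_le.1 (h s hs)).1])
    (fun s hs => by linarith [(abs_le.1 (h' s hs)).1])
  exact abs_le.2 ⟨by linarith, by linarith⟩

/-! ### The effect of a periodic signal -/

theorem intervalIntegrable_of_mem_Icc {u : ℝ → ℝ} (hm : Measurable u) (hu : ∀ t, u t ∈ Icc 0 1)
    (a b : ℝ) : IntervalIntegrable u volume a b :=
  (intervalIntegrable_const (c := (1 : ℝ))).mono_fun hm.aestronglyMeasurable
    (Filter.Eventually.of_forall fun s => by
      simpa [abs_of_nonneg (hu s).1] using (hu s).2)

/-- The green time of a periodic signal up to time `t` differs from its mean by at most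
`η (1 - η) Δ`. -/
theorem abs_integral_signal_sub_le {u : ℝ → ℝ} {η Δ : ℝ} (hΔ : 0 < Δ) (hη : η ∈ Icc 0 1)
    (hm : Measurable u) (hu : ∀ t, u t ∈ Icc 0 1) (hper : Function.Periodic u Δ)
    (hgreen : ∫ t in (0 : ℝ)..Δ, u t = η * Δ) (t : ℝ) :
    |∫ s in (0 : ℝ)..t, (u s - η)| ≤ η * (1 - η) * Δ := by
  have hui : ∀ a b, IntervalIntegrable u volume a b := intervalIntegrable_of_mem_Icc hm hu
  have hi : ∀ a b, IntervalIntegrable (fun s => u s - η) volume a b := fun a b =>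
    (hui a b).sub intervalIntegrable_const
  have hper' : Function.Periodic (fun s => u s - η) Δ := fun s => by simp [hper s]
  have hzero : ∫ s in (0 : ℝ)..Δ, (u s - η) = 0 := by
    rw [intervalIntegral.integral_sub (hui _ _) intervalIntegrable_const, hgreen]
    simp [mul_comm]
  -- Whole cycles contribute nothing to the integral, so `t` may be reduced modulo `Δ`.
  obtain ⟨s, hs, hst⟩ : ∃ s ∈ Icc 0 Δ,
      ∫ r in (0 : ℝ)..t, (u r - η) = ∫ r in (0 : ℝ)..s, (u r - η) := by
    have hmem := toIcoMod_mem_Ico hΔ 0 t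
    rw [zero_add] at hmem
    refine ⟨toIcoMod hΔ 0 t, ⟨hmem.1, hmem.2.le⟩, ?_⟩
    have h1 := hper'.intervalIntegral_add_zsmul_eq (toIcoDiv hΔ 0 t) (toIcoMod hΔ 0 t) hi
    rw [toIcoMod_add_toIcoDiv_zsmul] at h1
    rw [hper'.intervalIntegral_add_eq (toIcoMod hΔ 0 t) 0, zero_add, hzero, smul_zero] at h1
    rw [← intervalIntegral.integral_add_adjacent_intervals (hi 0 (toIcoMod hΔ 0 t)) (hi _ t), h1,
      add_zero]
  have hsplit := intervalIntegral.integral_add_adjacent_intervals (hui 0 s) (hui s Δ)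
  have h0 : 0 ≤ ∫ r in (0 : ℝ)..s, u r :=
    intervalIntegral.integral_nonneg hs.1 fun r _ => (hu r).1
  have h1 : 0 ≤ ∫ r in s..Δ, u r :=
    intervalIntegral.integral_nonneg hs.2 fun r _ => (hu r).1
  have h2 : ∫ r in (0 : ℝ)..s, u r ≤ s := by
    simpa using intervalIntegral.integral_mono_on hs.1 (hui 0 s) intervalIntegrable_const
      fun r _ => (hu r).2
  have h3 : ∫ r in s..Δ, u r ≤ Δ - s := by
    simpa using intervalIntegral.integral_mono_on hs.2 (hui s Δ) intervalIntegrable_const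
      fun r _ => (hu r).2
  rw [hst, intervalIntegral.integral_sub (hui _ _) intervalIntegrable_const]
  simp only [intervalIntegral.integral_const, sub_zero, smul_eq_mul]
  rw [hgreen] at hsplit
  set G := ∫ r in (0 : ℝ)..s, u r
  set H := ∫ r in s..Δ, u r
  obtain ⟨hη0, hη1⟩ := hη
  -- With `G + H = η Δ`, the upper bound comes from `G - η s = (1 - η) G - η (s - G)` and `G ≤ η Δ`;
  -- the lower one from `s ≤ Δ - H` and `0 ≤ G`.
  refine abs_le.2 ⟨?_, ?_⟩
  · nlinarith [mul_nonneg hη0 (sub_nonneg.2 h3), mul_nonneg (sub_nonneg.2 hη1) h0]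
  · nlinarith [mul_nonneg hη0 (sub_nonneg.2 h2), mul_nonneg (sub_nonneg.2 hη1) h1]

/-! ### Networks -/

variable {ι : Type*} [Fintype ι] (net : SignalNetwork ι)

theorem wellFounded_next : WellFounded fun j k => net.next j = some k := by
  have : Std.Irrefl (Relation.TransGen fun j k => net.next j = some k) := ⟨net.acyclic⟩
  exact (Finite.wellFounded_of_trans_of_irrefl
    (Relation.TransGen fun j k => net.next j = some k)).mono fun _ _ h => Relation.TransGen.single h

/-- Without spillback the effective supply is `min {C_j, C_k}`. -/
theorem downstream_of_noSpillback {N : ι → ℝ → ℝ → ℝ} (ns : net.NoSpillback N)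
    (c : ι → ℝ → ℝ) {j k : ι} (hjk : net.next j = some k) {t : ℝ} (ht : t ∈ Icc 0 net.T) :
    net.downstream c N j t =
      min (net.link j).capacity (net.link k).capacity * ∫ s in (0 : ℝ)..t, c j s := by
  have hdown : net.downstream c N j t = ∫ s in (0 : ℝ)..t,
      min (net.link j).capacity ((net.link k).supply (N k) s) * c j s := by
    simp only [downstream, hjk]
  rw [hdown, ← intervalIntegral.integral_const_mul]
  refine intervalIntegral.integral_congr_ae ?_
  have h := (ae_restrict_iff' measurableSet_Icc).1 (ns k)
  filter_upwards [h] with s hs hst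
  rw [uIoc_of_le ht.1] at hst
  rw [Link.supply, if_pos (hs ⟨hst.1.le, hst.2.trans ht.2⟩)]

theorem downstream_nonneg {N : ι → ℝ → ℝ → ℝ} (ns : net.NoSpillback N) {c : ι → ℝ → ℝ} {j : ι}
    (hc : ∀ k, net.next j = some k → ∀ t, 0 ≤ c j t) {t : ℝ} (ht : t ∈ Icc 0 net.T) :
    0 ≤ net.downstream c N j t := by
  rcases hj : net.next j with _ | k
  · have h : net.downstream c N j t = ∫ s in (0 : ℝ)..t, net.exitSupply j s := by
      simp only [downstream, hj]
    rw [h]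
    exact intervalIntegral.integral_nonneg ht.1 fun s hs =>
      net.exitSupply_nonneg j s ⟨hs.1, hs.2.trans ht.2⟩
  · rw [net.downstream_of_noSpillback ns c hj ht]
    exact mul_nonneg
      (le_min (net.link j).capacity_nonneg (net.link k).capacity_nonneg)
      (intervalIntegral.integral_nonneg ht.1 fun s _ => hc k hj s)

theorem onOff_nonneg (j k : ι) (h : net.next j = some k) (t : ℝ) : 0 ≤ net.onOff j t := by
  rcases net.u_mem j k h t with h | h <;> simp [onOff, h]

theorem continuum_nonneg (j k : ι) (h : net.next j = some k) (t : ℝ) : 0 ≤ net.continuum j t :=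
  (net.η_mem j k h).1.le

theorem upstream_nonneg_of {N : ι → ℝ → ℝ → ℝ} {i : ι} {t : ℝ} (ht : t ∈ Icc 0 net.T)
    (h : ∀ j, net.next j = some i → 0 ≤ N j t (net.link j).b) : 0 ≤ net.upstream N i t := by
  classical
  refine add_nonneg ((net.link i).Nini_nonneg (left_mem_Icc.2 (net.link i).a_lt_b.le)) ?_
  split_ifs
  · exact Finset.sum_nonneg fun j hj => h j (Finset.mem_filter.1 hj).2
  · exact intervalIntegral.integral_nonneg ht.1 fun s hs =>
      net.demand_nonneg i s ⟨hs.1, hs.2.trans ht.2⟩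

/-- Needed to keep the Lax–Hopf infima bounded below. Induction runs over the incoming links only,
since without spillback the downstream conditions do not depend on `N`. -/
theorem IsSolution.upstream_nonneg {net : SignalNetwork ι} {c : ι → ℝ → ℝ} {N : ι → ℝ → ℝ → ℝ}
    (hN : net.IsSolution c N) (ns : net.NoSpillback N)
    (hc : ∀ j k, net.next j = some k → ∀ t, 0 ≤ c j t) (i : ι) :
    ∀ t ∈ Icc 0 net.T, 0 ≤ net.upstream N i t := by
  induction i using net.wellFounded_next.induction with
  | _ i ih =>
    intro t ht
    refine net.upstream_nonneg_of ht fun j hj => ?_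
    rw [hN j t ht _ (right_mem_Icc.2 (net.link j).a_lt_b.le)]
    exact (net.link j).moskowitz_nonneg (ih j hj)
      (fun s hs => net.downstream_nonneg ns (hc j) hs) t _

theorem signalBound_nonneg (j : ι) : 0 ≤ net.signalBound j := by
  rcases hj : net.next j with _ | k
  · simp [signalBound, hj]
  · have hη := net.η_mem j k hj
    have h : net.signalBound j = net.η j * (1 - net.η j) * net.cycle k *
        min (net.link j).capacity (net.link k).capacity := by simp only [signalBound, hj]
    rw [h]
    exact mul_nonneg (mul_nonneg (mul_nonneg hη.1.le (sub_nonneg.2 hη.2)) (net.cycle_pos k).le)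
      (le_min (net.link j).capacity_nonneg (net.link k).capacity_nonneg)

/-! ### The error of a single link -/

theorem abs_downstream_sub_le {NΔ N0 : ι → ℝ → ℝ → ℝ} (nsΔ : net.NoSpillback NΔ)
    (ns0 : net.NoSpillback N0) (j : ι) {t : ℝ} (ht : t ∈ Icc 0 net.T) :
    |net.downstream net.onOff NΔ j t - net.downstream net.continuum N0 j t| ≤
      net.signalBound j := by
  rcases hj : net.next j with _ | k
  · simp [signalBound, downstream, hj]
  · have h : net.signalBound j = net.η j * (1 - net.η j) * net.cycle k *
        min (net.link j).capacity (net.link k).capacity := by simp only [signalBound, hj]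
    have hη := net.η_mem j k hj
    have hu : ∀ s, net.u j s ∈ Icc (0 : ℝ) 1 := fun s => by
      rcases net.u_mem j k hj s with h | h <;> simp [h]
    have hui : IntervalIntegrable (net.u j) volume 0 t :=
      intervalIntegrable_of_mem_Icc (net.u_meas j k hj) hu 0 t
    have hC : 0 ≤ min (net.link j).capacity (net.link k).capacity :=
      le_min (net.link j).capacity_nonneg (net.link k).capacity_nonneg
    rw [net.downstream_of_noSpillback nsΔ _ hj ht, net.downstream_of_noSpillback ns0 _ hj ht, h,
      ← mul_sub, abs_mul, abs_of_nonneg hC, mul_comm]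
    refine mul_le_mul_of_nonneg_right ?_ hC
    simp only [onOff, continuum]
    rw [← intervalIntegral.integral_sub hui intervalIntegrable_const]
    exact abs_integral_signal_sub_le (net.cycle_pos k) ⟨hη.1.le, hη.2⟩ (net.u_meas j k hj) hu
      (net.u_periodic j k hj) (net.u_green j k hj) t

theorem linkError_le_signalBound {NΔ N0 : ι → ℝ → ℝ → ℝ} (nsΔ : net.NoSpillback NΔ)
    (ns0 : net.NoSpillback N0) {j : ι} {U : ℝ → ℝ} (hU : ∀ t ∈ Icc 0 net.T, 0 ≤ U t)
    {t x : ℝ} (ht : t ∈ Icc 0 net.T) (hx : x ∈ Icc (net.link j).a (net.link j).b) :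
    net.linkError NΔ N0 j U t x ≤ net.signalBound j :=
  (net.link j).abs_moskowitz_sub_le hU
    (fun _ hs => net.downstream_nonneg nsΔ (net.onOff_nonneg j) hs) hU
    (fun _ hs => net.downstream_nonneg ns0 (net.continuum_nonneg j) hs) ht hx
    (net.signalBound_nonneg j) (fun s _ => by simpa using net.signalBound_nonneg j)
    (fun _ hs => net.abs_downstream_sub_le nsΔ ns0 j ⟨hs.1, hs.2.trans ht.2⟩)

theorem linkError_le_maxLinkError {NΔ N0 : ι → ℝ → ℝ → ℝ} (nsΔ : net.NoSpillback NΔ)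
    (ns0 : net.NoSpillback N0) {j : ι} {U : ℝ → ℝ} (hU : ∀ t ∈ Icc 0 net.T, 0 ≤ U t)
    {s t x : ℝ} (ht : t ∈ Icc 0 net.T) (hs : s ∈ Icc 0 t)
    (hx : x ∈ Icc (net.link j).a (net.link j).b) :
    net.linkError NΔ N0 j U s x ≤ net.maxLinkError NΔ N0 j U t := by
  -- The signal bound makes the set of errors bounded above, so that `sSup` is not the default value
  -- `0`.
  refine le_csSup ⟨net.signalBound j, ?_⟩ ⟨s, hs, x, hx, rfl⟩
  rintro _ ⟨r, hr, y, hy, rfl⟩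
  exact net.linkError_le_signalBound nsΔ ns0 hU ⟨hr.1, hr.2.trans ht.2⟩ hy

theorem maxLinkError_nonneg (NΔ N0 : ι → ℝ → ℝ → ℝ) (j : ι) (U : ℝ → ℝ) (t : ℝ) :
    0 ≤ net.maxLinkError NΔ N0 j U t := by
  refine Real.sSup_nonneg ?_
  rintro _ ⟨s, -, y, -, rfl⟩
  exact abs_nonneg _

theorem maxLinkError_mono {NΔ N0 : ι → ℝ → ℝ → ℝ} (nsΔ : net.NoSpillback NΔ)
    (ns0 : net.NoSpillback N0) {j : ι} {U : ℝ → ℝ} (hU : ∀ t ∈ Icc 0 net.T, 0 ≤ U t)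
    {s t : ℝ} (ht : t ∈ Icc 0 net.T) (hst : s ≤ t) :
    net.maxLinkError NΔ N0 j U s ≤ net.maxLinkError NΔ N0 j U t := by
  refine Real.sSup_le ?_ (net.maxLinkError_nonneg NΔ N0 j U t)
  rintro _ ⟨r, hr, y, hy, rfl⟩
  exact net.linkError_le_maxLinkError nsΔ ns0 hU ht ⟨hr.1, hr.2.trans hst⟩ hy

/-! ### The set of preceding links -/

theorem mem_preceding {i j : ι} : j ∈ net.preceding i ↔
    Relation.ReflTransGen (fun k l => net.next k = some l) j i := by
  simp [preceding]

open Classical in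
/-- The links that precede `i` are `i` and the links that precede one of its predecessors; as a
link has only one successor, no link is counted twice. -/
theorem sum_preceding (g : ι → ℝ) (i : ι) :
    ∑ l ∈ net.preceding i, g l =
      g i + ∑ j ∈ Finset.univ.filter (fun j => net.next j = some i),
        ∑ l ∈ net.preceding j, g l := by
  have hdisj : Set.PairwiseDisjoint
      ((Finset.univ.filter fun j => net.next j = some i : Finset ι) : Set ι) net.preceding := by
    intro j hj k hk hne
    rw [Finset.mem_coe, Finset.mem_filter] at hj hk
    refine Finset.disjoint_left.2 fun l hlj hlk => ?_
    rw [mem_preceding] at hlj hlk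
    -- A path from `p` to another predecessor `q` of `i` must pass through `i`, and `q` leads back
    -- to `i`: a cycle.
    have key : ∀ {p q}, net.next p = some i → net.next q = some i → p ≠ q →
        ¬ Relation.ReflTransGen (fun k l => net.next k = some l) p q := by
      intro p q hp hq hpq h
      rcases h.cases_head with h | ⟨m, hm, hmq⟩
      · exact hpq h
      · obtain rfl : i = m := Option.some.inj (hp.symm.trans hm)
        exact net.acyclic i (Relation.TransGen.tail' hmq hq)
    have hu : Relator.RightUnique fun k l => net.next k = some l := fun a b c hb hc =>
      Option.some.inj (hb.symm.trans hc)
    -- Two links reachable from `l` lie on the unique path that starts at `l`, so one of them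
    -- precedes the other.
    rcases Relation.ReflTransGen.total_of_right_unique hu hlj hlk with h | h
    · exact key hj.2 hk.2 hne h
    · exact key hk.2 hj.2 hne.symm h
  have hmem : i ∉ (Finset.univ.filter fun j => net.next j = some i).biUnion net.preceding := by
    intro h
    obtain ⟨j, hj, hij⟩ := Finset.mem_biUnion.1 h
    exact net.acyclic i (Relation.TransGen.tail' (net.mem_preceding.1 hij)
      (Finset.mem_filter.1 hj).2)
  have hset : net.preceding i =
      insert i ((Finset.univ.filter fun j => net.next j = some i).biUnion net.preceding) := by
    ext l
    simp only [mem_preceding, Finset.mem_insert, Finset.mem_biUnion, Finset.mem_filter,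
      Finset.mem_univ, true_and]
    rw [Relation.ReflTransGen.cases_tail_iff]
    exact or_congr eq_comm ⟨fun ⟨j, h, h'⟩ => ⟨j, h', h⟩, fun ⟨j, h, h'⟩ => ⟨j, h', h⟩⟩
  rw [hset, Finset.sum_insert hmem, Finset.sum_biUnion hdisj]

/-! ### Propagation of the errors through the network -/

open Classical in
theorem abs_upstream_sub_le (N N' : ι → ℝ → ℝ → ℝ) (i : ι) (t : ℝ) :
    |net.upstream N i t - net.upstream N' i t| ≤
      ∑ j ∈ Finset.univ.filter (fun j => net.next j = some i),
        |N j t (net.link j).b - N' j t (net.link j).b| := by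
  rw [upstream, upstream, add_sub_add_left_eq_sub]
  split_ifs
  · rw [← Finset.sum_sub_distrib]
    exact Finset.abs_sum_le_sum_abs _ _
  · rw [sub_self, abs_zero]
    exact Finset.sum_nonneg fun _ _ => abs_nonneg _

theorem abs_solution_sub_le {NΔ N0 : ι → ℝ → ℝ → ℝ}
    (hΔ : net.IsSolution net.onOff NΔ) (h0 : net.IsSolution net.continuum N0)
    (nsΔ : net.NoSpillback NΔ) (ns0 : net.NoSpillback N0)
    {U : ι → ℝ → ℝ} (hU : ∀ j, U j = net.upstream NΔ j ∨ U j = net.upstream N0 j)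
    (hU' : ∀ j, ∀ t ∈ Icc 0 net.T, 0 ≤ U j t) (i : ι) :
    ∀ t ∈ Icc 0 net.T, ∀ x ∈ Icc (net.link i).a (net.link i).b,
      |NΔ i t x - N0 i t x| ≤ ∑ j ∈ net.preceding i, net.maxLinkError NΔ N0 j (U j) t := by
  classical
  induction i using net.wellFounded_next.induction with
  | _ i ih =>
    intro t ht x hx
    -- The errors are taken at the final time `t`; by monotonicity `E` then bounds the upstream
    -- difference at every `s ≤ t`.
    set E := ∑ j ∈ Finset.univ.filter (fun j => net.next j = some i),
      ∑ l ∈ net.preceding j, net.maxLinkError NΔ N0 l (U l) t with hE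
    have hE0 : 0 ≤ E := Finset.sum_nonneg fun j _ => Finset.sum_nonneg fun l _ =>
      net.maxLinkError_nonneg NΔ N0 l (U l) t
    have hup : ∀ s ∈ Icc 0 t, |net.upstream NΔ i s - net.upstream N0 i s| ≤ E := by
      intro s hs
      refine (net.abs_upstream_sub_le NΔ N0 i s).trans (Finset.sum_le_sum fun j hj => ?_)
      refine (ih j (Finset.mem_filter.1 hj).2 s ⟨hs.1, hs.2.trans ht.2⟩ _
        (right_mem_Icc.2 (net.link j).a_lt_b.le)).trans (Finset.sum_le_sum fun l _ => ?_)
      exact net.maxLinkError_mono nsΔ ns0 (hU' l) ht hs.2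
    have hupΔ := hΔ.upstream_nonneg nsΔ net.onOff_nonneg i
    have hup0 := h0.upstream_nonneg ns0 net.continuum_nonneg i
    have hdΔ : ∀ s ∈ Icc 0 net.T, 0 ≤ net.downstream net.onOff NΔ i s :=
      fun s hs => net.downstream_nonneg nsΔ (net.onOff_nonneg i) hs
    have hd0 : ∀ s ∈ Icc 0 net.T, 0 ≤ net.downstream net.continuum N0 i s :=
      fun s hs => net.downstream_nonneg ns0 (net.continuum_nonneg i) hs
    have herr := net.linkError_le_maxLinkError nsΔ ns0 (hU' i) ht (right_mem_Icc.2 ht.1) hx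
    rw [sum_preceding, ← hE, hΔ i t ht x hx, h0 i t ht x hx]
    -- The choice of `U i` fixes the intermediate function: upstream on-and-off with downstream
    -- continuum, or the reverse.
    rcases hU i with h | h
    · have := (net.link i).abs_moskowitz_sub_le hupΔ hd0 hup0 hd0 ht hx hE0 hup
        (fun s _ => by simpa using hE0)
      rw [h] at herr ⊢
      exact (abs_sub_le _ _ _).trans (add_le_add herr this)
    · have := (net.link i).abs_moskowitz_sub_le hupΔ hdΔ hup0 hdΔ ht hx hE0 hup
        (fun s _ => by simpa using hE0)
      rw [h] at herr ⊢
      rw [add_comm]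
      exact (abs_sub_le _ _ _).trans (add_le_add this herr)

end SignalNetwork

theorem corollary4p2 {ι : Type*} [Fintype ι] (net : SignalNetwork ι)
    (NΔ N0 : ι → ℝ → ℝ → ℝ)
    (hΔ : net.IsSolution net.onOff NΔ) (h0 : net.IsSolution net.continuum N0)
    (nsΔ : net.NoSpillback NΔ) (ns0 : net.NoSpillback N0)
    (U : ι → ℝ → ℝ) (hU : ∀ j, U j = net.upstream NΔ j ∨ U j = net.upstream N0 j) :
    (∀ i, ∀ t ∈ Set.Icc 0 net.T, ∀ x ∈ Set.Icc (net.link i).a (net.link i).b,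
      |NΔ i t x - N0 i t x| ≤ ∑ j ∈ net.preceding i, net.maxLinkError NΔ N0 j (U j) t) ∧
    (∀ j, ∀ t ∈ Set.Icc 0 net.T, ∀ x ∈ Set.Icc (net.link j).a (net.link j).b,
      net.linkError NΔ N0 j (U j) t x ≤ net.signalBound j) := by
  have hU' : ∀ j, ∀ t ∈ Set.Icc 0 net.T, 0 ≤ U j t := by
    intro j
    rcases hU j with h | h <;> rw [h]
    exacts [hΔ.upstream_nonneg nsΔ net.onOff_nonneg j,
      h0.upstream_nonneg ns0 net.continuum_nonneg j]
  exact ⟨net.abs_solution_sub_le hΔ h0 nsΔ ns0 hU hU',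
    fun j _ ht _ hx => net.linkError_le_signalBound nsΔ ns0 (hU' j) ht hx⟩
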